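/- There exists an $\infty$-effective complete well-structured transition system $\mathfrak S=(S,\xrightarrow{F},\le)$, with representation map $r$, such that it is undecidable, given (a code of) a state $s_0\in S$, whether the procedure $\mathbf{Clover}_{\mathfrak S}(s_0)$ terminates. Here the notions are as follows. *Complete WSTS.* $(S,\le)$ is a partial order that is a well-quasi-ordering and a continuous dcpo (every non-empty directed subset has a least upper bound, and every $x$ is the least upper bound of the non-empty directed set $\{y : y\ll x\}$, where $y\ll x$ means that every non-empty directed $D$ with $\mathrm{lub}(D)\ge x$ contains an element above $y$). $F$ is a finite family of partial maps $f:S\rightharpoonup S$ that are partial monotonic and partial continuous: $\mathrm{dom} f$ is Scott-open, and $\mathrm{lub}(f(D))=f(\mathrm{lub}(D))$ for every non-empty directed $D\subseteq\mathrm{dom} f$ with a least upper bound. We write $s\to s'$ iff $s'=f(s)$ for some $f\in F$, and $F^*$ for the set of all finite compositions of maps in $F$, including the identity. *Lub-acceleration.* For $g\in F^*$, $g^\infty$ has domain $\mathrm{dom}\, g$, and $g^\infty(x)=\mathrm{lub}\{g^n(x): n\in\mathbb N\}$ if $x<g(x)$, and $g^\infty(x)=g(x)$ otherwise. *$\infty$-effective.*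 $r:E\to S$ is a surjection from a set $E\subseteq\mathbb N$ of codes. A partial function $h$ on $S$ is computable if there is an algorithm that, on every code $e\in E$ of a state $s$, decides whether $s\in\mathrm{dom}\, h$ and, if so, returns a code of $h(s)$; a predicate on states is decidable if there is an algorithm that decides it on all codes in $E$ (nothing is required outside $E$). It is required that $\le$ is decidable, that every $f\in F$ is computable, and that the maps $g^\infty$, $g\in F^*$, are computable, uniformly in a word over $F$ denoting $g$. *The procedure $\mathbf{Clover}_{\mathfrak S}(s_0)$.* Start with $A=\{s_0\}$. As long as some successor of an element of $A$ is not below any element of $A$, choose $(g,a)\in F^*\times A$ with $a\in\mathrm{dom}\, g$ and replace $A$ by $A\cup\{g^\infty(a)\}$. When the loop stops, return the set of maximal elements of $A$. The choices must be fair: on every infinite execution with successive values $A_0,A_1,\dots$ of $A$, for every $m$, every pair $(g,a)\in F^*\times A_m$ with $a\in\mathrm{dom}\, g$ is chosen at some stage $n\ge m$. The procedure terminates on $s_0$ if it has no infinite fair execution. -/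

import Mathlib

namespace CompleteWSTS

section Order

variable {S : Type*} [PartialOrder S]

/-- A dcpo: every non-empty directed subset has a least upper bound. -/
def IsDcpo (S : Type*) [PartialOrder S] : Prop :=
  ∀ D : Set S, D.Nonempty → DirectedOn (· ≤ ·) D → ∃ u, IsLUB D u

/-- The way-below relation. -/
def WayBelow (x y : S) : Prop :=
  ∀ D : Set S, D.Nonempty → DirectedOn (· ≤ ·) D → ∀ u, IsLUB D u → y ≤ u → ∃ z ∈ D, x ≤ z

/-- A continuous dcpo: the elements way below `x` form a directed set with least upper bound `x`. -/
structure IsContinuousDcpo (S : Type*) [PartialOrder S] : Prop where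
  dcpo : IsDcpo S
  nonempty : ∀ x : S, {y : S | WayBelow y x}.Nonempty
  directed : ∀ x : S, DirectedOn (· ≤ ·) {y : S | WayBelow y x}
  isLUB : ∀ x : S, IsLUB {y : S | WayBelow y x} x

/-- Scott-open sets. -/
def ScottOpen (U : Set S) : Prop :=
  IsUpperSet U ∧
    ∀ D : Set S, D.Nonempty → DirectedOn (· ≤ ·) D → ∀ u, IsLUB D u → u ∈ U → ∃ z ∈ D, z ∈ U

/-- Partial monotonic maps: the domain is upward-closed and the map is monotonic on it. -/
def PartialMonotonic (f : S →. S) : Prop :=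
  IsUpperSet f.Dom ∧ ∀ x y x' y', x ≤ y → x' ∈ f x → y' ∈ f y → x' ≤ y'

/-- Partial continuous maps: the domain is Scott-open and the map preserves the least upper
bounds of the directed subsets of its domain. -/
def PartialContinuous (f : S →. S) : Prop :=
  ScottOpen f.Dom ∧
    ∀ D : Set S, D ⊆ f.Dom → D.Nonempty → DirectedOn (· ≤ ·) D →
      ∀ u, IsLUB D u → ∃ v ∈ f u, IsLUB (f.image D) v

/-- The least upper bound of `E`, defined when it exists. -/
noncomputable def lub (E : Set S) : Part S :=
  ⟨∃ u, IsLUB E u, fun h => h.choose⟩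

/-- The `n`-th iterate of a partial map. -/
def iter (f : S →. S) : ℕ → S →. S
  | 0 => fun x => Part.some x
  | n + 1 => fun x => (iter f n x).bind f

open Classical in
/-- The lub-acceleration of `f`. For `f` partial continuous on a dcpo, the iterates of `f` on `x`
form an increasing sequence as soon as `x < f x`, so that `accel f` and `f` have the same domain. -/
noncomputable def accel (f : S →. S) : S →. S := fun x =>
  (f x).bind fun y => if x < y then lub {z | ∃ n, z ∈ iter f n x} else Part.some y

/-- The Hoare quasi-ordering on sets of states. -/
def HoareLE (A B : Set S) : Prop := ∀ x ∈ A, ∃ y ∈ B, x ≤ y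

end Order

section Systems

variable {S : Type*} {k : ℕ}

/-- The map denoted by a word over the finitely many transition functions `F 0, …, F (k - 1)`;
the first letter is applied first, and the empty word denotes the identity. -/
def comp (F : Fin k → S →. S) : List (Fin k) → S →. S
  | [] => fun x => Part.some x
  | i :: w => fun x => (F i x).bind (comp F w)

/-- The set `F^*` of all compositions of transition functions. -/
def star (F : Fin k → S →. S) : Set (S →. S) := Set.range (comp F)

/-- The set of one-step successors of states in `A`. -/
def post (F : Fin k → S →. S) (A : Set S) : Set S := {t | ∃ s ∈ A, ∃ i, t ∈ F i s}

variable [PartialOrder S]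

/-- Complete (functional) well-structured transition systems: the states form a continuous
directed complete well partial order, and the finitely many transition functions are partial
monotonic and partial continuous. -/
structure IsCompleteWSTS (F : Fin k → S →. S) : Prop where
  wpo : WellQuasiOrdered (fun s t : S => s ≤ t)
  continuousDcpo : IsContinuousDcpo S
  monotonic : ∀ i, PartialMonotonic (F i)
  continuous : ∀ i, PartialContinuous (F i)

/-- The sequence of sets `A n` and choices `(g n, a n)` is an infinite execution of the procedure
`Clover` from `s₀` whose choices are fair: starting from `{s₀}`, the loop test `Post A ≰♭ A`
succeeds at every stage, the chosen acceleration is added to `A`, and every pair in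
`F^* × A m` that can be chosen is chosen at some stage `n ≥ m`. -/
structure IsInfiniteFairExecution (F : Fin k → S →. S) (s₀ : S)
    (A : ℕ → Set S) (g : ℕ → S →. S) (a : ℕ → S) : Prop where
  init : A 0 = {s₀}
  test : ∀ n, ¬ HoareLE (post F (A n)) (A n)
  choice_map : ∀ n, g n ∈ star F
  choice_state : ∀ n, a n ∈ A n
  choice_dom : ∀ n, a n ∈ (g n).Dom
  step : ∀ n, ∃ b ∈ accel (g n) (a n), A (n + 1) = A n ∪ {b}
  fair : ∀ m, ∀ h ∈ star F, ∀ c ∈ A m, c ∈ h.Dom → ∃ n, m ≤ n ∧ g n = h ∧ a n = c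

/-- The procedure `Clover` terminates on `s₀`: it has no infinite fair execution. (The procedure
never blocks: if the loop test `Post A ≰♭ A` succeeds then some pair can be chosen.) -/
def CloverTerminates (F : Fin k → S →. S) (s₀ : S) : Prop :=
  ¬ ∃ A g a, IsInfiniteFairExecution F s₀ A g a

/-- The answer `o` (either "undefined", or a code of a state) is correct for the partial state `t`,
where `r` is a representation map. -/
def CorrectAnswer (r : ℕ →. S) (t : Part S) : Option ℕ → Prop
  | none => ¬ t.Dom
  | some e => ∃ s ∈ t, s ∈ r e

/-- Effectiveness with respect to a representation map `r`, that is, a surjection onto the states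
from the set `r.Dom` of codes: the ordering is decidable, and, for every transition function, one
can decide from a code whether the function is defined, and compute a code of its value if it is.
Nothing is required of the algorithms on natural numbers that are not codes. -/
structure IsEffective (F : Fin k → S →. S) (r : ℕ →. S) : Prop where
  surjective : ∀ s, ∃ e, s ∈ r e
  order : ∃ φ : ℕ × ℕ →. Bool, Partrec φ ∧ ∀ d e s t, s ∈ r d → t ∈ r e →
    ∃ b ∈ φ (d, e), (b = true ↔ s ≤ t)
  map : ∀ i, ∃ φ : ℕ →. Option ℕ, Partrec φ ∧ ∀ e s, s ∈ r e →
    ∃ o ∈ φ e, CorrectAnswer r (F i s) o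

/-- `∞`-effectiveness: moreover the lub-accelerations of all maps in `F^*` are computable, by an
algorithm that is given the map as a word. -/
structure IsInftyEffective (F : Fin k → S →. S) (r : ℕ →. S) : Prop extends IsEffective F r where
  accel : ∃ φ : List (Fin k) × ℕ →. Option ℕ, Partrec φ ∧ ∀ w e s, s ∈ r e →
    ∃ o ∈ φ (w, e), CorrectAnswer r (accel (comp F w) s) o

/-- A set of states is decidable (with respect to the representation map `r`). -/
def DecidableOnCodes {S : Type*} (r : ℕ →. S) (P : S → Prop) : Prop :=
  ∃ φ : ℕ →. Bool, Partrec φ ∧ ∀ e s, s ∈ r e → ∃ b ∈ φ e, (b = true ↔ P s)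

end Systems

end CompleteWSTS

/-!
The states are the pairs `(p, n)` of natural numbers in lexicographic order, with a greatest
element added: a well-order of type `ω ^ 2 + 1`, hence a well-quasi-order and a continuous dcpo.
Both transition functions keep the program number `p`. They cut the positions `n` into the
intervals `[k ^ 2, (k + 1) ^ 2)`. As long as the program `p` is not seen to halt with the resource
bound `n`, the `i`-th transition adds one to `n` on the intervals with `k % 2 = i`, and falls back to
the start of the interval on the others; once `p` is seen to halt, both transitions add one.
The position `0` is an exception: both transitions fix the states `(p, 0)`, which are limits for
`p ≠ 0`. With this, both transitions are monotone and continuous.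

In either case arbitrarily large positions are reachable from `(p, 1)`, by alternating between the
two transitions. If `p` does not halt, then this takes longer and longer blocks of the same letter,
and no single word can be accelerated beyond some position (`exists_run_le`): on a long interval
of the wrong parity its first letter falls back to the start. So every stage of the procedure is
bounded by some `(p, B)`, and the loop never stops (`not_cloverTerminates_of_not_halts`). If `p`
halts, fairness brings the execution beyond the halting time, from where one acceleration yields
`(p + 1, 0)`, which is above everything reachable (`cloverTerminates_of_halts`). Hence termination
from `(p, 1)` is the halting problem for `p`.

Accelerations are nevertheless computable (`accelSearch_sound`, `accelSearch_complete`): one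
iterates the word until either a fixed point is reached or `p` is seen to halt, in which case the
iterates are unbounded; by `exists_run_le` one of the two happens.
-/

open CompleteWSTS Encodable Denumerable
open Nat.Partrec (Code)

namespace CloverUndecidable

/-! ### Well-ordered sets with a greatest element as continuous dcpos -/

section WellOrder

variable {S : Type*} [LinearOrder S]

theorem exists_isLUB [WellFoundedLT S] [OrderTop S] (D : Set S) : ∃ u, IsLUB D u := by
  have hne : (upperBounds D).Nonempty := ⟨⊤, fun _ _ => le_top⟩
  exact ⟨wellFounded_lt.min _ hne, WellFounded.min_mem _ _ hne,
    fun b hb => not_lt.1 (WellFounded.not_lt_min wellFounded_lt _ hb)⟩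

theorem wayBelow_of_lt {x y : S} (h : x < y) : WayBelow x y := by
  intro D _ _ u hu hyu
  obtain ⟨z, hz, hxz, -⟩ := hu.exists_between (h.trans_le hyu)
  exact ⟨z, hz, hxz.le⟩

theorem wayBelow_of_covBy {x y : S} (h : x ⋖ y) : WayBelow y y := by
  intro D _ _ u hu hyu
  obtain ⟨z, hz, hxz, -⟩ := hu.exists_between (h.lt.trans_le hyu)
  exact ⟨z, hz, h.ge_of_gt hxz⟩

theorem wayBelow_of_isMin {x y : S} (h : IsMin x) : WayBelow x y := by
  rintro D ⟨z, hz⟩ _ u _ _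
  exact ⟨z, hz, h.isBot z⟩

theorem isContinuousDcpo_of_wellFoundedLT [WellFoundedLT S] [OrderTop S] : IsContinuousDcpo S where
  dcpo D _ _ := exists_isLUB D
  nonempty x := by
    by_cases hx : IsMin x
    · exact ⟨x, wayBelow_of_isMin hx⟩
    · obtain ⟨y, hy⟩ := not_isMin_iff.1 hx
      exact ⟨y, wayBelow_of_lt hy⟩
  directed _ a ha b hb := ⟨max a b, by rcases max_choice a b with h | h <;> rwa [h],
    le_max_left a b, le_max_right a b⟩
  isLUB x := by
    refine ⟨fun y hy => ?_, fun u hu => ?_⟩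
    · obtain ⟨z, hz, hyz⟩ := hy {x} ⟨x, rfl⟩ (by simp [DirectedOn]) x isLUB_singleton le_rfl
      exact hyz.trans (le_of_eq hz)
    · by_contra hlt
      rw [not_le] at hlt
      have hcov : u ⋖ x := ⟨hlt, fun c huc hcx => (hu (wayBelow_of_lt hcx)).not_gt huc⟩
      exact hlt.not_ge (hu (wayBelow_of_covBy hcov))

/-- On a linear order, a monotone map only has to be checked for continuity at the limits, since
the least upper bound of `D` otherwise belongs to `D`. The map is assumed to fix the limits. -/
theorem isLUB_image_of_fixes_limits {f : S → S} (hf : Monotone f)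
    (hfix : ∀ u, Order.IsSuccPrelimit u → f u = u)
    (hlim : ∀ u, Order.IsSuccPrelimit u → ∀ v < u, ∃ x < u, v < f x)
    {D : Set S} {u : S} (hu : IsLUB D u) : IsLUB (f '' D) (f u) := by
  refine ⟨hf.mem_upperBounds_image hu.1, fun b hb => ?_⟩
  by_contra hlt
  rw [not_le] at hlt
  by_cases huD : u ∈ D
  · exact hlt.not_ge (hb ⟨u, huD, rfl⟩)
  · have key : ∀ x < u, ∃ d ∈ D, x < d ∧ d < u := fun x hx => by
      obtain ⟨d, hd, hxd, hdu⟩ := hu.exists_between hx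
      exact ⟨d, hd, hxd, hdu.lt_of_ne fun h => huD (h ▸ hd)⟩
    have hpre : Order.IsSuccPrelimit u := fun a ha => by
      obtain ⟨d, -, had, hdu⟩ := key a ha.lt
      exact ha.2 had hdu
    rw [hfix u hpre] at hlt
    obtain ⟨x, hx, hbx⟩ := hlim u hpre b hlt
    obtain ⟨d, hd, hxd, -⟩ := key x hx
    exact (hbx.trans_le (hf hxd.le)).not_ge (hb ⟨d, hd, rfl⟩)

end WellOrder

/-! ### Total transition functions and their accelerations -/

section Total

variable {S : Type*} {f : S → S}

theorem dom_total (f : S → S) : PFun.Dom (fun x => Part.some (f x)) = Set.univ :=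
  Set.eq_univ_of_forall fun _ => trivial

theorem iter_total (f : S → S) (n : ℕ) (x : S) :
    iter (fun x => Part.some (f x)) n x = Part.some (f^[n] x) := by
  induction n with
  | zero => rfl
  | succ n ih => simp [iter, ih, Function.iterate_succ_apply']

variable [PartialOrder S]

theorem partialMonotonic_total (hf : Monotone f) :
    PartialMonotonic (fun x => Part.some (f x)) := by
  refine ⟨by rw [dom_total]; exact isUpperSet_univ, fun x y x' y' hxy hx hy => ?_⟩
  rw [Part.mem_some_iff] at hx hy
  rw [hx, hy]
  exact hf hxy

theorem partialContinuous_total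
    (hf : ∀ (D : Set S) (u : S), IsLUB D u → IsLUB (f '' D) (f u)) :
    PartialContinuous (fun x => Part.some (f x)) := by
  refine ⟨?_, fun D _ _ _ u hu => ⟨f u, Part.mem_some _, ?_⟩⟩
  · rw [dom_total]
    exact ⟨isUpperSet_univ, fun D ⟨z, hz⟩ _ _ _ _ => ⟨z, hz, trivial⟩⟩
  · convert hf D u hu using 1
    ext y
    simp [PFun.image, SetRel.image, PFun.graph', eq_comm]

theorem lub_eq_some {E : Set S} {u : S} (h : IsLUB E u) : lub E = Part.some u := by
  have hex : ∃ u, IsLUB E u := ⟨u, h⟩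
  exact Part.eq_some_iff.2 ⟨hex, hex.choose_spec.unique h⟩

theorem accel_total_of_not_lt {x : S} (h : ¬ x < f x) :
    accel (fun x => Part.some (f x)) x = Part.some (f x) := by
  simp [accel, h]

theorem accel_total_of_lt {x u : S} (h : x < f x) (hu : IsLUB (Set.range fun n => f^[n] x) u) :
    accel (fun x => Part.some (f x)) x = Part.some u := by
  have : {z | ∃ n, z ∈ iter (fun x => Part.some (f x)) n x} = Set.range fun n => f^[n] x := by
    ext z
    simp [iter_total, eq_comm]
  simp [accel, h, this, lub_eq_some hu]

theorem isLUB_of_mem_accel_total {x b : S} (h : x < f x)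
    (hb : b ∈ accel (fun x => Part.some (f x)) x) : IsLUB (Set.range fun n => f^[n] x) b := by
  have hE : {z | ∃ n, z ∈ iter (fun x => Part.some (f x)) n x} = Set.range fun n => f^[n] x := by
    ext z
    simp [iter_total, eq_comm]
  simp only [accel, Part.bind_some, h, if_true, hE] at hb
  obtain ⟨hd, rfl⟩ := hb
  exact hd.choose_spec

theorem le_of_mem_accel_total {x b : S} (hb : b ∈ accel (fun x => Part.some (f x)) x) :
    f x ≤ b := by
  by_cases h : x < f x
  · exact (isLUB_of_mem_accel_total h hb).1 ⟨1, rfl⟩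
  · rw [accel_total_of_not_lt h, Part.mem_some_iff] at hb
    exact hb.ge

/-- An acceleration from `x` stays below every post-fixed point above `x`. -/
theorem mem_accel_total_le (hf : Monotone f) {x u b : S} (hx : x ≤ u) (hu : f u ≤ u)
    (hb : b ∈ accel (fun x => Part.some (f x)) x) : b ≤ u := by
  by_cases h : x < f x
  · refine (isLUB_of_mem_accel_total h hb).2 ?_
    rintro _ ⟨n, rfl⟩
    induction n with
    | zero => exact hx
    | succ n ih =>
      simp only [Function.iterate_succ_apply']
      exact (hf ih).trans hu
  · rw [accel_total_of_not_lt h, Part.mem_some_iff] at hb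
    exact hb ▸ (hf hx).trans hu

end Total

/-! ### The transition system -/

/-- The states `(p, n)`, ordered lexicographically, and a greatest element: the well-order of
type `ω ^ 2 + 1`. The state `(p, n)` stands for the program with number `p` at position `n`. -/
abbrev State : Type := WithTop (ℕ ×ₗ ℕ)

/-- The state at position `n` in the fibre of the program `p`. -/
def st (p n : ℕ) : State := ((toLex (p, n) : ℕ ×ₗ ℕ) : WithTop (ℕ ×ₗ ℕ))

/-- Whether the program with number `p` is seen to halt on input `0` with the resource bound `n`. -/
def halts (p n : ℕ) : Bool := (Code.evaln n (ofNat Code p) 0).isSome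

/-- Whether the `i`-th transition increases the position `n`. Before the program is seen to halt,
this depends on the parity of `⌊√n⌋`. Position `0` is excluded since `(p + 1, 0)` is a limit. -/
def active (i p n : ℕ) : Bool := decide (n ≠ 0) && (halts p n || decide (n.sqrt % 2 = i))

/-- The `i`-th transition on positions: it increases an active position, and otherwise falls back
to the start of the interval `[k ^ 2, (k + 1) ^ 2)` that contains the position. -/
def next (i p n : ℕ) : ℕ := if active i p n then n + 1 else n.sqrt ^ 2

/-- The effect on positions of a word of transitions. -/
def run (w : List (Fin 2)) (p n : ℕ) : ℕ := w.foldl (fun m (i : Fin 2) => next i p m) n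

/-- The map on states acting by `h p` on the fibre of the program `p`. -/
def fibrewise (h : ℕ → ℕ → ℕ) : State → State :=
  WithTop.map fun x => toLex ((ofLex x).1, h (ofLex x).1 (ofLex x).2)

/-- The two transition functions. -/
def trans (i : Fin 2) : State →. State := fun x => Part.some (fibrewise (next i) x)

theorem st_le_st {p n q m : ℕ} : st p n ≤ st q m ↔ p < q ∨ p = q ∧ n ≤ m := by
  simp [st, Prod.Lex.toLex_le_toLex]

theorem st_lt_st {p n q m : ℕ} : st p n < st q m ↔ p < q ∨ p = q ∧ n < m := by
  simp [st, Prod.Lex.toLex_lt_toLex]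

theorem st_lt_top (p n : ℕ) : st p n < ⊤ := WithTop.coe_lt_top _

theorem eq_top_or_st (x : State) : x = ⊤ ∨ ∃ p n, x = st p n := by
  induction x using WithTop.recTopCoe with
  | top => exact Or.inl rfl
  | coe x => exact Or.inr ⟨(ofLex x).1, (ofLex x).2, rfl⟩

theorem isLUB_fibre {p : ℕ} {E : Set State} (hE : ∀ x ∈ E, x ≤ st (p + 1) 0)
    (hcof : ∀ m, ∃ x ∈ E, st p m ≤ x) : IsLUB E (st (p + 1) 0) := by
  refine ⟨hE, fun b hb => ?_⟩
  rcases eq_top_or_st b with rfl | ⟨q, l, rfl⟩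
  · exact le_top
  · obtain ⟨x, hx, hle⟩ := hcof (l + 1)
    have := st_le_st.1 (hle.trans (hb hx))
    rw [st_le_st]
    omega

@[simp] theorem fibrewise_top (h : ℕ → ℕ → ℕ) : fibrewise h ⊤ = ⊤ := rfl

@[simp] theorem fibrewise_st (h : ℕ → ℕ → ℕ) (p n : ℕ) :
    fibrewise h (st p n) = st p (h p n) := rfl

theorem iterate_fibrewise (h : ℕ → ℕ → ℕ) (p n j : ℕ) :
    (fibrewise h)^[j] (st p n) = st p ((h p)^[j] n) := by
  induction j with
  | zero => rfl
  | succ j ih => simp only [Function.iterate_succ_apply', ih, fibrewise_st]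

theorem fibrewise_monotone {h : ℕ → ℕ → ℕ} (hh : ∀ p, Monotone (h p)) :
    Monotone (fibrewise h) := by
  intro x y hxy
  rcases eq_top_or_st y with rfl | ⟨q, m, rfl⟩
  · exact le_top
  rcases eq_top_or_st x with rfl | ⟨p, n, rfl⟩
  · exact absurd hxy (st_lt_top q m).not_ge
  · rw [fibrewise_st, fibrewise_st, st_le_st]
    rcases st_le_st.1 hxy with h1 | ⟨rfl, h1⟩
    · exact Or.inl h1
    · exact Or.inr ⟨rfl, hh p h1⟩

/-! ### The effect of transitions on positions -/

theorem halts_mono {p n m : ℕ} (h : n ≤ m) (hn : halts p n = true) : halts p m = true := by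
  obtain ⟨x, hx⟩ := Option.isSome_iff_exists.1 hn
  exact Option.isSome_iff_exists.2 ⟨x, Code.evaln_mono h hx⟩

theorem exists_halts_iff (c : Code) : (∃ n, halts (encode c) n = true) ↔ (c.eval 0).Dom := by
  simp only [halts, ofNat_encode, Option.isSome_iff_exists, Part.dom_iff_mem]
  constructor
  · rintro ⟨n, x, hx⟩
    exact ⟨x, Code.evaln_complete.2 ⟨n, hx⟩⟩
  · rintro ⟨x, hx⟩
    obtain ⟨n, hn⟩ := Code.evaln_complete.1 hx
    exact ⟨n, x, hn⟩

theorem next_le (i p n : ℕ) : next i p n ≤ n + 1 := by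
  unfold next
  split
  · exact le_rfl
  · exact (Nat.sqrt_le' n).trans n.le_succ

theorem sqrt_sq_le_next (i p n : ℕ) : n.sqrt ^ 2 ≤ next i p n := by
  unfold next
  split
  · exact (Nat.sqrt_le' n).trans n.le_succ
  · exact le_rfl

theorem next_monotone (i p : ℕ) : Monotone (next i p) := by
  intro n m hnm
  rcases (Nat.sqrt_le_sqrt hnm).lt_or_eq with hlt | heq
  · have h1 : n < (n.sqrt + 1) ^ 2 := Nat.lt_succ_sqrt' n
    have h2 : (n.sqrt + 1) ^ 2 ≤ m.sqrt ^ 2 := Nat.pow_le_pow_left hlt 2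
    have h3 := next_le i p n
    have h4 := sqrt_sq_le_next i p m
    omega
  · by_cases hm : active i p m = true
    · rw [next, next, if_pos hm]
      split
      · omega
      · have := Nat.sqrt_le' n
        omega
    · have hn : ¬ active i p n = true := fun hn => hm <| by
        simp only [active, Bool.and_eq_true, Bool.or_eq_true, decide_eq_true_eq] at hn ⊢
        exact ⟨by omega, hn.2.imp (halts_mono hnm) fun h => heq ▸ h⟩
      rw [next, next, if_neg hm, if_neg hn, heq]

@[simp] theorem next_zero (i p : ℕ) : next i p 0 = 0 := by simp [next, active]

theorem next_of_halts (i : ℕ) {p n : ℕ} (hn : n ≠ 0) (h : halts p n = true) :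
    next i p n = n + 1 := by
  simp [next, active, hn, h]

theorem exists_next_eq_succ (p : ℕ) {n : ℕ} (hn : n ≠ 0) : ∃ i : Fin 2, next i p n = n + 1 :=
  ⟨⟨n.sqrt % 2, Nat.mod_lt _ two_pos⟩, by simp [next, active, hn]⟩

@[simp] theorem run_nil (p n : ℕ) : run [] p n = n := rfl

@[simp] theorem run_cons (i : Fin 2) (w : List (Fin 2)) (p n : ℕ) :
    run (i :: w) p n = run w p (next i p n) := rfl

theorem run_monotone (w : List (Fin 2)) (p : ℕ) : Monotone (run w p) := by
  induction w with
  | nil => exact monotone_id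
  | cons i w ih => exact ih.comp (next_monotone i p)

theorem run_le (w : List (Fin 2)) (p n : ℕ) : run w p n ≤ n + w.length := by
  induction w generalizing n with
  | nil => rfl
  | cons i w ih =>
    have h1 := ih (next i p n)
    have h2 := next_le i p n
    simp only [run_cons, List.length_cons]
    omega

theorem run_zero (w : List (Fin 2)) (p : ℕ) : run w p 0 = 0 := by
  induction w with
  | nil => rfl
  | cons i w ih => simp [ih]

theorem run_of_halts (w : List (Fin 2)) {p n : ℕ} (hn : n ≠ 0) (h : halts p n = true) :
    run w p n = n + w.length := by
  induction w generalizing n with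
  | nil => rfl
  | cons i w ih =>
    rw [run_cons, next_of_halts i hn h, ih n.succ_ne_zero (halts_mono n.le_succ h),
      List.length_cons]
    omega

/-- If the program does not halt, then every word has arbitrarily large post-fixed points: on a
long interval of the wrong parity, its first letter falls back to the start of the interval, from
which the other letters cannot reach the end. -/
theorem exists_run_le {p : ℕ} (hp : ∀ n, ¬ halts p n = true) (w : List (Fin 2)) (n : ℕ) :
    ∃ B, n ≤ B ∧ run w p B ≤ B := by
  cases w with
  | nil => exact ⟨n, le_rfl, le_rfl⟩
  | cons i w =>
    -- The parity of `k` differs from `i`, and the interval of `k` has more than `w.length` elements.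
    obtain ⟨k, hk⟩ : ∃ k, k = 2 * (n + w.length) + 1 + i := ⟨_, rfl⟩
    have hsq : k ≤ k ^ 2 := Nat.le_self_pow two_ne_zero k
    have hsqrt : (k ^ 2 + w.length).sqrt = k := Nat.sqrt_add_eq' k (by omega)
    refine ⟨k ^ 2 + w.length, by omega, ?_⟩
    have hi : ¬ k % 2 = i := by omega
    have hnext : next i p (k ^ 2 + w.length) = k ^ 2 := by
      simp [next, active, hp, hsqrt, hi]
    rw [run_cons, hnext]
    exact run_le w p _

theorem comp_trans (w : List (Fin 2)) :
    comp trans w = fun x => Part.some (fibrewise (run w) x) := by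
  induction w with
  | nil =>
    funext x
    rcases eq_top_or_st x with rfl | ⟨p, n, rfl⟩ <;> rfl
  | cons i w ih =>
    funext x
    change (Part.some (fibrewise (next i) x)).bind (comp trans w) = _
    rw [ih, Part.bind_some]
    rcases eq_top_or_st x with rfl | ⟨p, n, rfl⟩ <;> rfl

theorem fibrewise_run_monotone (w : List (Fin 2)) : Monotone (fibrewise (run w)) :=
  fibrewise_monotone (run_monotone w)

/-! ### The system is a complete well-structured transition system -/

theorem not_isSuccPrelimit_st_succ (p n : ℕ) : ¬ Order.IsSuccPrelimit (st p (n + 1)) := by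
  intro h
  refine h (st p n) ⟨st_lt_st.2 (by omega), fun c hc hc' => ?_⟩
  rcases eq_top_or_st c with rfl | ⟨q, m, rfl⟩
  · exact hc'.not_ge le_top
  · rw [st_lt_st] at hc hc'
    omega

theorem isLUB_image_fibrewise_next (i : ℕ) (D : Set State) (u : State) (hu : IsLUB D u) :
    IsLUB (fibrewise (next i) '' D) (fibrewise (next i) u) := by
  refine isLUB_image_of_fixes_limits (fibrewise_monotone (next_monotone i)) ?_ ?_ hu
  · intro u hlim
    rcases eq_top_or_st u with rfl | ⟨p, _ | n, rfl⟩
    · rfl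
    · simp
    · exact absurd hlim (not_isSuccPrelimit_st_succ p n)
  · intro u hlim v hv
    rcases eq_top_or_st v with rfl | ⟨q, m, rfl⟩
    · exact absurd hv not_top_lt
    rcases eq_top_or_st u with rfl | ⟨p, _ | n, rfl⟩
    · exact ⟨st (q + 1) 0, st_lt_top _ _, by simp [st_lt_st]⟩
    · -- The start of the interval number `m + 1` is never moved down.
      refine ⟨st q ((m + 1) ^ 2), ?_, ?_⟩
      · rw [st_lt_st] at hv ⊢
        omega
      · have h1 := sqrt_sq_le_next i q ((m + 1) ^ 2)
        rw [Nat.sqrt_eq'] at h1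
        have h2 : m + 1 ≤ (m + 1) ^ 2 := Nat.le_self_pow two_ne_zero _
        rw [fibrewise_st, st_lt_st]
        omega
    · exact absurd hlim (not_isSuccPrelimit_st_succ p n)

theorem isCompleteWSTS_trans : IsCompleteWSTS trans where
  wpo := wellQuasiOrdered_le
  continuousDcpo := isContinuousDcpo_of_wellFoundedLT
  monotonic i := partialMonotonic_total (fibrewise_monotone (next_monotone i))
  continuous i := partialContinuous_total (isLUB_image_fibrewise_next i)

/-! ### Effectiveness -/

/-- The state denoted by an optional pair; `none` denotes the greatest element. -/
def ofPair : Option (ℕ × ℕ) → State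
  | none => ⊤
  | some x => st x.1 x.2

/-- The representation map, total on the natural numbers. -/
def rep : ℕ →. State := fun e => Part.some (ofPair (ofNat (Option (ℕ × ℕ)) e))

theorem mem_rep_encode (o : Option (ℕ × ℕ)) : ofPair o ∈ rep (encode o) := by
  simp [rep]

theorem exists_ofPair_eq (s : State) : ∃ o, ofPair o = s := by
  rcases eq_top_or_st s with rfl | ⟨p, n, rfl⟩
  · exact ⟨none, rfl⟩
  · exact ⟨some (p, n), rfl⟩

theorem primrec_sqrt : Primrec Nat.sqrt := Nat.Primrec'.prim_iff₁.1 Nat.Primrec'.sqrt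

theorem primrec_halts : Primrec₂ halts :=
  Primrec.option_isSome.comp <| Code.primrec_evaln.comp <|
    (Primrec.snd.pair ((Primrec.ofNat Code).comp Primrec.fst)).pair (Primrec.const 0)

theorem primrec_active : Primrec fun x : ℕ × ℕ × ℕ => active x.1 x.2.1 x.2.2 := by
  have hn : Primrec fun x : ℕ × ℕ × ℕ => x.2.2 := Primrec.snd.comp Primrec.snd
  have hp : Primrec fun x : ℕ × ℕ × ℕ => x.2.1 := Primrec.fst.comp Primrec.snd
  exact Primrec.and.comp (Primrec.eq.comp hn (Primrec.const 0)).not.decide <|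
    Primrec.or.comp (primrec_halts.comp hp hn) <|
      (Primrec.eq.comp (Primrec.nat_mod.comp (primrec_sqrt.comp hn) (Primrec.const 2))
        Primrec.fst).decide

theorem primrec_next : Primrec fun x : ℕ × ℕ × ℕ => next x.1 x.2.1 x.2.2 := by
  have hn : Primrec fun x : ℕ × ℕ × ℕ => x.2.2 := Primrec.snd.comp Primrec.snd
  refine (Primrec.ite (Primrec.eq.comp primrec_active (Primrec.const true))
    (Primrec.succ.comp hn)
    (Primrec.nat_mul.comp (primrec_sqrt.comp hn) (primrec_sqrt.comp hn))).of_eq fun x => ?_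
  simp [next, sq]

theorem primrec_run : Primrec fun x : List (Fin 2) × ℕ × ℕ => run x.1 x.2.1 x.2.2 :=
  have hnext : Primrec₂ fun (x : List (Fin 2) × ℕ × ℕ) (y : ℕ × Fin 2) => next y.2 x.2.1 y.1 :=
    primrec_next.comp <| (Primrec.fin_val.comp (Primrec.snd.comp Primrec.snd)).pair <|
      (Primrec.fst.comp (Primrec.snd.comp Primrec.fst)).pair (Primrec.fst.comp Primrec.snd)
  (Primrec.list_foldl Primrec.fst (Primrec.snd.comp Primrec.snd) hnext).of_eq fun _ => rfl

/-- The ordering on optional pairs, as a Boolean function. -/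
def leBool (a b : Option (ℕ × ℕ)) : Bool :=
  Option.casesOn b true fun y => Option.casesOn a false fun x =>
    decide (x.1 < y.1) || (decide (x.1 = y.1) && decide (x.2 ≤ y.2))

theorem leBool_iff (a b : Option (ℕ × ℕ)) : leBool a b = true ↔ ofPair a ≤ ofPair b := by
  rcases b with _ | y
  · simp [leBool, ofPair]
  · rcases a with _ | x
    · simp [leBool, ofPair, st]
    · simp [leBool, ofPair, st_le_st]

theorem primrec_leBool : Primrec₂ leBool := by
  have hx : Primrec fun z : ((Option (ℕ × ℕ) × Option (ℕ × ℕ)) × ℕ × ℕ) × ℕ × ℕ => z.2 :=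
    Primrec.snd
  have hy : Primrec fun z : ((Option (ℕ × ℕ) × Option (ℕ × ℕ)) × ℕ × ℕ) × ℕ × ℕ => z.1.2 :=
    Primrec.snd.comp Primrec.fst
  refine Primrec.option_casesOn Primrec.snd (Primrec.const true) ?_
  refine Primrec.option_casesOn (Primrec.fst.comp Primrec.fst) (Primrec.const false) ?_
  exact Primrec.or.comp
    (Primrec.nat_lt.comp (Primrec.fst.comp hx) (Primrec.fst.comp hy)).decide <|
    Primrec.and.comp (Primrec.eq.comp (Primrec.fst.comp hx) (Primrec.fst.comp hy)).decide
      (Primrec.nat_le.comp (Primrec.snd.comp hx) (Primrec.snd.comp hy)).decide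

/-- One round of the search for the acceleration of the word `w` at `(p, n)`. When `w` does
not increase `n`, the answer is immediate. Otherwise the round looks at the `j`-th iterate, and
succeeds if the program is seen to halt there, in which case the iterates are unbounded, or if that
iterate is a fixed point. -/
def accelSearch (w : List (Fin 2)) (x : ℕ × ℕ) (j : ℕ) : Option (ℕ × ℕ) :=
  if run w x.1 x.2 ≤ x.2 then some (x.1, run w x.1 x.2)
  else if halts x.1 ((run w x.1)^[j] x.2) = true then some (x.1 + 1, 0)
  else if run w x.1 ((run w x.1)^[j] x.2) = (run w x.1)^[j] x.2 then
    some (x.1, (run w x.1)^[j] x.2)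
  else none

theorem primrec_accelSearch :
    Primrec fun z : (List (Fin 2) × ℕ × ℕ) × ℕ => accelSearch z.1.1 z.1.2 z.2 := by
  have hw : Primrec fun z : (List (Fin 2) × ℕ × ℕ) × ℕ => z.1.1 := Primrec.fst.comp Primrec.fst
  have hp : Primrec fun z : (List (Fin 2) × ℕ × ℕ) × ℕ => z.1.2.1 :=
    Primrec.fst.comp (Primrec.snd.comp Primrec.fst)
  have hn : Primrec fun z : (List (Fin 2) × ℕ × ℕ) × ℕ => z.1.2.2 :=
    Primrec.snd.comp (Primrec.snd.comp Primrec.fst)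
  have hrun : Primrec fun z : (List (Fin 2) × ℕ × ℕ) × ℕ => run z.1.1 z.1.2.1 z.1.2.2 :=
    primrec_run.comp (hw.pair (hp.pair hn))
  have hstep : Primrec₂ fun (z : (List (Fin 2) × ℕ × ℕ) × ℕ) (m : ℕ) => run z.1.1 z.1.2.1 m :=
    primrec_run.comp <| (hw.comp Primrec.fst).pair <| (hp.comp Primrec.fst).pair Primrec.snd
  have hm : Primrec fun z : (List (Fin 2) × ℕ × ℕ) × ℕ =>
      (run z.1.1 z.1.2.1)^[z.2] z.1.2.2 :=
    Primrec.nat_iterate Primrec.snd hn hstep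
  refine Primrec.ite (Primrec.nat_le.comp hrun hn) (Primrec.option_some.comp (hp.pair hrun)) ?_
  refine Primrec.ite (Primrec.eq.comp (primrec_halts.comp hp hm) (Primrec.const true))
    (Primrec.option_some.comp ((Primrec.succ.comp hp).pair (Primrec.const 0))) ?_
  exact Primrec.ite (Primrec.eq.comp (primrec_run.comp (hw.pair (hp.pair hm))) hm)
    (Primrec.option_some.comp (hp.pair hm)) (Primrec.const none)

/-- If the program is seen to halt at some iterate of `w`, then from there on every letter of `w`
adds one, so that the iterates are unbounded. -/
theorem isLUB_iterates_of_halts {w : List (Fin 2)} {p n j : ℕ} (h : n < run w p n)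
    (hj : halts p ((run w p)^[j] n) = true) :
    IsLUB (Set.range fun l => (fibrewise (run w))^[l] (st p n)) (st (p + 1) 0) := by
  have hmono : Monotone fun l => (run w p)^[l] n :=
    (run_monotone w p).monotone_iterate_of_le_map h.le
  have hw : 1 ≤ w.length := by
    have := run_le w p n
    omega
  have hn : n ≠ 0 := by
    rintro rfl
    rw [run_zero] at h
    exact h.false
  refine isLUB_fibre ?_ fun m => ⟨_, ⟨j + m, rfl⟩, ?_⟩
  · rintro _ ⟨l, rfl⟩
    simp only [iterate_fibrewise, st_le_st]
    omega
  · simp only [iterate_fibrewise, st_le_st]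
    refine Or.inr ⟨trivial, ?_⟩
    induction m with
    | zero => exact Nat.zero_le _
    | succ m ih =>
      have h0 : n ≤ (run w p)^[j + m] n := hmono (Nat.zero_le (j + m))
      have h1 : (run w p)^[j] n ≤ (run w p)^[j + m] n := hmono (Nat.le_add_right j m)
      rw [← add_assoc, Function.iterate_succ_apply',
        run_of_halts w (by omega) (halts_mono h1 hj)]
      omega

theorem accelSearch_sound {w : List (Fin 2)} {x y : ℕ × ℕ} {j : ℕ}
    (h : accelSearch w x j = some y) :
    ofPair (some y) ∈ accel (comp trans w) (ofPair (some x)) := by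
  obtain ⟨p, n⟩ := x
  rw [comp_trans]
  simp only [accelSearch] at h
  split_ifs at h with h1 h2 h3
  · obtain rfl := Option.some.inj h
    rw [accel_total_of_not_lt]
    · simp [ofPair]
    · simp only [ofPair, fibrewise_st, st_lt_st]
      omega
  · obtain rfl := Option.some.inj h
    rw [not_le] at h1
    simp only [ofPair]
    rw [accel_total_of_lt _ (isLUB_iterates_of_halts h1 h2)]
    · exact Part.mem_some _
    · rw [fibrewise_st, st_lt_st]
      omega
  · obtain rfl := Option.some.inj h
    rw [not_le] at h1
    simp only [ofPair]
    have hmono : Monotone fun l => (run w p)^[l] n :=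
      (run_monotone w p).monotone_iterate_of_le_map h1.le
    rw [accel_total_of_lt (u := st p ((run w p)^[j] n))]
    · exact Part.mem_some _
    · rw [fibrewise_st, st_lt_st]
      omega
    · refine IsGreatest.isLUB ⟨⟨j, iterate_fibrewise _ _ _ _⟩, ?_⟩
      rintro _ ⟨l, rfl⟩
      simp only [iterate_fibrewise, st_le_st]
      refine Or.inr ⟨trivial, ?_⟩
      have h4 : (run w p)^[l] n ≤ (run w p)^[l + j] n := hmono (Nat.le_add_right l j)
      rwa [Function.iterate_add_apply, Function.iterate_fixed h3] at h4

/-- If no fixed point is reached, the iterates are unbounded, so that the program must halt, and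
this is seen at some iterate. -/
theorem accelSearch_complete (w : List (Fin 2)) (x : ℕ × ℕ) :
    ∃ j y, accelSearch w x j = some y := by
  obtain ⟨p, n⟩ := x
  by_contra! hcon
  have hlt : n < run w p n := by
    by_contra h
    exact hcon 0 (p, run w p n) (by simp only [accelSearch]; rw [if_pos (not_lt.1 h)])
  have hnone : ∀ j, ¬ halts p ((run w p)^[j] n) = true ∧
      run w p ((run w p)^[j] n) ≠ (run w p)^[j] n := by
    intro j
    constructor
    · intro h
      exact hcon j (p + 1, 0) (by simp only [accelSearch]; rw [if_neg hlt.not_ge, if_pos h])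
    · intro h
      by_cases h' : halts p ((run w p)^[j] n) = true
      · exact hcon j (p + 1, 0) (by simp only [accelSearch]; rw [if_neg hlt.not_ge, if_pos h'])
      · exact hcon j (p, (run w p)^[j] n)
          (by simp only [accelSearch]; rw [if_neg hlt.not_ge, if_neg h', if_pos h])
  have hmono : Monotone fun l => (run w p)^[l] n :=
    (run_monotone w p).monotone_iterate_of_le_map hlt.le
  have hge : ∀ j, j ≤ (run w p)^[j] n := by
    intro j
    induction j with
    | zero => exact Nat.zero_le _
    | succ j ih =>
      have h1 : (run w p)^[j] n ≤ (run w p)^[j + 1] n := hmono j.le_succ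
      have h2 := (hnone j).2
      rw [Function.iterate_succ_apply'] at h1 ⊢
      omega
  have hp : ∀ m, ¬ halts p m = true := fun m hm => (hnone m).1 (halts_mono (hge m) hm)
  obtain ⟨B, hnB, hB⟩ := exists_run_le hp w n
  have hbd : ∀ j, (run w p)^[j] n ≤ B := by
    intro j
    induction j with
    | zero => exact hnB
    | succ j ih =>
      rw [Function.iterate_succ_apply']
      exact (run_monotone w p ih).trans hB
  have := (hge (B + 1)).trans (hbd (B + 1))
  omega

/-- `accelSearch` on codes. The outer option is the state of the search, the inner one the answer,
which is never "undefined". -/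
def accelSearchCode (z : List (Fin 2) × ℕ) (j : ℕ) : Option (Option ℕ) :=
  Option.casesOn (ofNat (Option (ℕ × ℕ)) z.2) (some (some (encode (none : Option (ℕ × ℕ)))))
    fun x => (accelSearch z.1 x j).map fun y => some (encode (some y))

theorem primrec_accelSearchCode : Primrec₂ accelSearchCode := by
  refine Primrec.option_casesOn
    ((Primrec.ofNat (Option (ℕ × ℕ))).comp (Primrec.snd.comp Primrec.fst)) (Primrec.const _) ?_
  have harg : Primrec fun z : ((List (Fin 2) × ℕ) × ℕ) × ℕ × ℕ => ((z.1.1.1, z.2), z.1.2) :=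
    ((Primrec.fst.comp (Primrec.fst.comp Primrec.fst)).pair Primrec.snd).pair
      (Primrec.snd.comp Primrec.fst)
  have hcode : Primrec₂ fun (_ : ((List (Fin 2) × ℕ) × ℕ) × ℕ × ℕ) (y : ℕ × ℕ) =>
      (some (encode (some y)) : Option ℕ) :=
    Primrec.option_some.comp (Primrec.encode.comp (Primrec.option_some.comp Primrec.snd))
  exact Primrec.option_map (primrec_accelSearch.comp harg) hcode

theorem isEffective_trans : IsEffective trans rep where
  surjective s := by
    obtain ⟨o, rfl⟩ := exists_ofPair_eq s
    exact ⟨_, mem_rep_encode o⟩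
  order := by
    refine ⟨fun z => Part.some (leBool (ofNat _ z.1) (ofNat _ z.2)),
      (primrec_leBool.comp ((Primrec.ofNat _).comp Primrec.fst)
        ((Primrec.ofNat _).comp Primrec.snd)).to_comp.partrec, fun d e s t hs ht => ?_⟩
    rw [rep, Part.mem_some_iff] at hs ht
    exact ⟨_, Part.mem_some _, by rw [leBool_iff, hs, ht]⟩
  map i := by
    have hpr : Primrec fun e => (some (encode ((ofNat (Option (ℕ × ℕ)) e).map fun x =>
        (x.1, next i x.1 x.2))) : Option ℕ) := by
      refine Primrec.option_some.comp (Primrec.encode.comp (Primrec.option_map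
        (Primrec.ofNat _) ?_))
      exact (Primrec.fst.comp Primrec.snd).pair (primrec_next.comp
        ((Primrec.const _).pair Primrec.snd))
    refine ⟨_, hpr.to_comp.partrec, fun e s hs => ⟨_, Part.mem_some _, ?_⟩⟩
    rw [rep, Part.mem_some_iff] at hs
    refine ⟨_, Part.mem_some _, ?_⟩
    convert mem_rep_encode _ using 1
    rw [hs]
    cases ofNat (Option (ℕ × ℕ)) e <;> rfl

theorem isInftyEffective_trans : IsInftyEffective trans rep where
  toIsEffective := isEffective_trans
  accel := by
    refine ⟨_, Partrec.rfindOpt primrec_accelSearchCode.to_comp, fun w e s hs => ?_⟩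
    rw [rep, Part.mem_some_iff] at hs
    have hdom : (Nat.rfindOpt (accelSearchCode (w, e))).Dom := by
      rw [Nat.rfindOpt_dom]
      simp only [accelSearchCode]
      cases ofNat (Option (ℕ × ℕ)) e with
      | none => exact ⟨0, _, rfl⟩
      | some x =>
        obtain ⟨j, y, hy⟩ := accelSearch_complete w x
        exact ⟨j, some (encode (some y)), by simp [hy]⟩
    refine ⟨_, Part.get_mem hdom, ?_⟩
    obtain ⟨j, hj⟩ := Nat.rfindOpt_spec (Part.get_mem hdom)
    generalize Part.get _ hdom = o at hj ⊢
    simp only [accelSearchCode] at hj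
    cases hx : ofNat (Option (ℕ × ℕ)) e with
    | none =>
      rw [hx] at hj hs
      obtain rfl := Option.some.inj hj
      refine ⟨⊤, ?_, mem_rep_encode none⟩
      rw [hs, comp_trans, ofPair, accel_total_of_not_lt (by simp)]
      exact Part.mem_some _
    | some x =>
      rw [hx] at hj hs
      obtain ⟨y, hy, rfl⟩ := Option.map_eq_some_iff.1 hj
      exact ⟨_, hs ▸ accelSearch_sound hy, mem_rep_encode _⟩

/-! ### Termination from the states of a halting program -/

theorem cloverTerminates_of_halts {p t : ℕ} (ht : halts p t = true) :
    CloverTerminates trans (st p 1) := by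
  rintro ⟨A, g, a, hA⟩
  have hmonoA : Monotone A := monotone_nat_of_le_succ fun n => by
    obtain ⟨b, -, hb⟩ := hA.step n
    rw [hb]
    exact Set.subset_union_left
  -- The limit of the fibre is fixed by all transitions, and bounds all stages.
  have hbound : ∀ n, ∀ x ∈ A n, x ≤ st (p + 1) 0 := by
    intro n
    induction n with
    | zero =>
      intro x hx
      rw [hA.init] at hx
      rw [Set.mem_singleton_iff.1 hx, st_le_st]
      omega
    | succ n ih =>
      obtain ⟨b, hb, hstep⟩ := hA.step n
      rw [hstep]
      rintro x (hx | rfl)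
      · exact ih x hx
      · obtain ⟨w, hw⟩ := hA.choice_map n
        rw [← hw, comp_trans] at hb
        refine mem_accel_total_le (fibrewise_run_monotone w) (ih _ (hA.choice_state n)) ?_ hb
        rw [fibrewise_st, run_zero]
  have hacc : ∀ (w : List (Fin 2)) m, ∀ c ∈ A m, ∃ n, ∃ b ∈ A n, b ∈ accel (comp trans w) c := by
    intro w m c hc
    obtain ⟨n, -, hg, ha⟩ := hA.fair m (comp trans w) ⟨w, rfl⟩ c hc
      (by rw [comp_trans]; trivial)
    obtain ⟨b, hb, hstep⟩ := hA.step n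
    exact ⟨n + 1, b, by rw [hstep]; exact Or.inr rfl, hg ▸ ha ▸ hb⟩
  have hreach : ∀ m, ∃ n, ∃ x ∈ A n, st p (m + 1) ≤ x := by
    intro m
    induction m with
    | zero => exact ⟨0, st p 1, by rw [hA.init]; rfl, le_rfl⟩
    | succ m ih =>
      obtain ⟨n, x, hx, hle⟩ := ih
      obtain ⟨i, hi⟩ := exists_next_eq_succ p m.succ_ne_zero
      obtain ⟨n', b, hb, hacc⟩ := hacc [i] n x hx
      rw [comp_trans] at hacc
      refine ⟨n', b, hb, le_trans ?_ (le_of_mem_accel_total hacc)⟩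
      refine le_trans ?_ (fibrewise_run_monotone [i] hle)
      rw [fibrewise_st, run_cons, run_nil, hi]
  -- Beyond the halting time, a single acceleration reaches the limit of the fibre.
  obtain ⟨n, hn⟩ : ∃ n, st (p + 1) 0 ∈ A n := by
    obtain ⟨n, x, hx, hle⟩ := hreach t
    rcases eq_top_or_st x with rfl | ⟨q, m, rfl⟩
    · exact absurd (hbound n _ hx) (st_lt_top _ _).not_ge
    have h1 := st_le_st.1 hle
    have h2 := st_le_st.1 (hbound n _ hx)
    obtain rfl | ⟨rfl, rfl⟩ : p = q ∨ q = p + 1 ∧ m = 0 := by omega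
    · obtain ⟨n', b, hb, hacc⟩ := hacc [0] n _ hx
      have hm : halts p m = true := halts_mono (by omega) ht
      have hlt : m < run [0] p m := by
        rw [run_of_halts _ (by omega) hm]
        simp
      rw [comp_trans, accel_total_of_lt (by rw [fibrewise_st, st_lt_st]; omega)
        (isLUB_iterates_of_halts (j := 0) hlt hm), Part.mem_some_iff] at hacc
      exact ⟨n', hacc ▸ hb⟩
    · exact ⟨n, hx⟩
  refine hA.test n ?_
  rintro y ⟨x, hx, i, hy⟩
  refine ⟨_, hn, ?_⟩
  rw [trans, Part.mem_some_iff] at hy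
  rw [hy]
  refine (fibrewise_monotone (next_monotone i) (hbound n x hx)).trans ?_
  rw [fibrewise_st, next_zero]

/-! ### Non-termination from the states of a program that does not halt -/

/-- Every position but `0` is active for one of the two transitions, so that a set that contains
`(p, 1)` and covers its successors contains states above every `(p, m)`. -/
theorem not_hoareLE_post_of_bounded {p B : ℕ} {A : Set State} (h1 : st p 1 ∈ A)
    (hB : ∀ x ∈ A, x ≤ st p B) : ¬ HoareLE (post trans A) A := by
  intro hle
  have hreach : ∀ m, ∃ x ∈ A, st p (m + 1) ≤ x := by
    intro m
    induction m with
    | zero => exact ⟨_, h1, le_rfl⟩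
    | succ m ih =>
      obtain ⟨x, hx, hmx⟩ := ih
      obtain ⟨i, hi⟩ := exists_next_eq_succ p m.succ_ne_zero
      obtain ⟨y, hy, hxy⟩ := hle _ ⟨x, hx, i, Part.mem_some _⟩
      refine ⟨y, hy, le_trans ?_ hxy⟩
      refine le_trans ?_ (fibrewise_monotone (next_monotone i) hmx)
      rw [fibrewise_st, hi]
  obtain ⟨x, hx, hBx⟩ := hreach B
  have := st_le_st.1 (hBx.trans (hB x hx))
  omega

theorem exists_mem_accel (w : List (Fin 2)) (x : State) :
    ∃ b, b ∈ accel (comp trans w) x := by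
  rw [comp_trans]
  by_cases h : x < fibrewise (run w) x
  · obtain ⟨u, hu⟩ := exists_isLUB (Set.range fun n => (fibrewise (run w))^[n] x)
    exact ⟨u, by rw [accel_total_of_lt h hu]; exact Part.mem_some _⟩
  · exact ⟨_, by rw [accel_total_of_not_lt h]; exact Part.mem_some _⟩

/-- A schedule in which every pair of a word and a state occurs infinitely often. -/
def request (n : ℕ) : List (Fin 2) × State :=
  let z : List (Fin 2) × Option (ℕ × ℕ) := (decode n.unpair.1).getD ([], none)
  (z.1, ofPair z.2)

theorem exists_request_eq (w : List (Fin 2)) (x : State) (m : ℕ) :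
    ∃ n, m ≤ n ∧ request n = (w, x) := by
  obtain ⟨o, rfl⟩ := exists_ofPair_eq x
  exact ⟨Nat.pair (encode (w, o)) m, Nat.right_le_pair _ _, by simp [request]⟩

open Classical in
/-- The pair that is chosen at stage `n` from the set `A`: the requested one if it is available,
and otherwise the empty word at the initial state `s`. -/
noncomputable def choice (s : State) (A : Set State) (n : ℕ) : List (Fin 2) × State :=
  if (request n).2 ∈ A then request n else ([], s)

/-- The stages of the execution with choices `choice`, started at `s`. -/
noncomputable def stage (s : State) : ℕ → Set State
  | 0 => {s}
  | n + 1 => stage s n ∪ {(exists_mem_accel (choice s (stage s n) n).1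
      (choice s (stage s n) n).2).choose}

theorem stage_mono (s : State) : Monotone (stage s) :=
  monotone_nat_of_le_succ fun _ => Set.subset_union_left

theorem mem_stage (s : State) (n : ℕ) : s ∈ stage s n :=
  stage_mono s (Nat.zero_le n) rfl

theorem choice_mem_stage (s : State) (n : ℕ) : (choice s (stage s n) n).2 ∈ stage s n := by
  unfold choice
  split
  · assumption
  · exact mem_stage s n

theorem exists_stage_le {p : ℕ} (hp : ∀ n, ¬ halts p n = true) (n : ℕ) :
    ∃ B, ∀ x ∈ stage (st p 1) n, x ≤ st p B := by
  induction n with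
  | zero => exact ⟨1, fun x hx => (Set.mem_singleton_iff.1 hx).le⟩
  | succ n ih =>
    obtain ⟨B, hB⟩ := ih
    obtain ⟨B', hBB', hB'⟩ := exists_run_le hp (choice (st p 1) (stage (st p 1) n) n).1 B
    have hle : st p B ≤ st p B' := st_le_st.2 (by omega)
    refine ⟨B', ?_⟩
    rintro x (hx | rfl)
    · exact (hB x hx).trans hle
    · have hb := (exists_mem_accel (choice (st p 1) (stage (st p 1) n) n).1
        (choice (st p 1) (stage (st p 1) n) n).2).choose_spec
      simp only [comp_trans] at hb
      refine mem_accel_total_le (fibrewise_run_monotone _)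
        ((hB _ (choice_mem_stage _ n)).trans hle) ?_ (by simpa only [comp_trans] using hb)
      rw [fibrewise_st, st_le_st]
      omega

theorem not_cloverTerminates_of_not_halts {p : ℕ} (hp : ∀ n, ¬ halts p n = true) :
    ¬ CloverTerminates trans (st p 1) := by
  refine not_not.2 ⟨stage (st p 1), fun n => comp trans (choice (st p 1) (stage (st p 1) n) n).1,
    fun n => (choice (st p 1) (stage (st p 1) n) n).2, ?_⟩
  constructor
  · rfl
  · intro n
    obtain ⟨B, hB⟩ := exists_stage_le hp n
    exact not_hoareLE_post_of_bounded (mem_stage _ n) hB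
  · exact fun n => ⟨_, rfl⟩
  · exact choice_mem_stage _
  · intro n
    rw [comp_trans]
    trivial
  · exact fun n => ⟨_, (exists_mem_accel _ _).choose_spec, rfl⟩
  · rintro m _ ⟨w, rfl⟩ c hc -
    obtain ⟨n, hmn, hn⟩ := exists_request_eq w c m
    have hch : choice (st p 1) (stage (st p 1) n) n = (w, c) := by
      rw [choice, hn, if_pos (stage_mono _ hmn hc)]
    exact ⟨n, hmn, by simp only [hch], by simp only [hch]⟩

theorem cloverTerminates_iff (c : Code) :
    CloverTerminates trans (st (encode c) 1) ↔ (c.eval 0).Dom := by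
  rw [← exists_halts_iff]
  refine ⟨fun h => ?_, fun ⟨t, ht⟩ => cloverTerminates_of_halts ht⟩
  by_contra! hcon
  exact not_cloverTerminates_of_not_halts (fun n => by simpa using hcon n) h

theorem not_decidableOnCodes_cloverTerminates :
    ¬ DecidableOnCodes rep fun s => CloverTerminates trans s := by
  rintro ⟨φ, hφ, hspec⟩
  have hcode : Computable fun c : Code => encode (some (encode c, 1) : Option (ℕ × ℕ)) :=
    (Primrec.encode.comp (Primrec.option_some.comp
      (Primrec.encode.pair (Primrec.const 1)))).to_comp
  have hmem : ∀ c : Code, ∃ b ∈ φ (encode (some (encode c, 1) : Option (ℕ × ℕ))),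
      (b = true ↔ (c.eval 0).Dom) := fun c => by
    obtain ⟨b, hb, hiff⟩ := hspec _ _ (mem_rep_encode (some (encode c, 1)))
    exact ⟨b, hb, hiff.trans (cloverTerminates_iff c)⟩
  choose b hb hiff using hmem
  have hcomp : Computable b :=
    (hφ.comp hcode).of_eq_tot hb
  refine ComputablePred.halting_problem 0 (ComputablePred.computable_iff.2 ⟨b, hcomp, ?_⟩)
  funext c
  exact propext (hiff c).symm

end CloverUndecidable

theorem mainTheorem12 :
    ∃ (S : Type) (_ : PartialOrder S) (k : ℕ) (F : Fin k → S →. S) (r : ℕ →. S),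
      CompleteWSTS.IsCompleteWSTS F ∧
      CompleteWSTS.IsInftyEffective F r ∧
      ¬ CompleteWSTS.DecidableOnCodes r (fun s₀ => CompleteWSTS.CloverTerminates F s₀) :=
  ⟨CloverUndecidable.State, inferInstance, 2, CloverUndecidable.trans, CloverUndecidable.rep,
    CloverUndecidable.isCompleteWSTS_trans, CloverUndecidable.isInftyEffective_trans,
    CloverUndecidable.not_decidableOnCodes_cloverTerminates⟩
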